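/- Fix real parameters $\eta>0$, $\alpha\ge 0$, $v^\star>0$, $\varphi,p^\star,q^\star,\omega_0,\omega_{\rm g},r_{\rm g},l_{\rm g},v_{\rm g}\in\mathbb R$ such that the grid impedance $z:=r_{\rm g}+j\omega_{\rm g}l_{\rm g}\in\mathbb C$ is nonzero, and put $y:=z^{-1}$, $\omega_\Delta:=\omega_0-\omega_{\rm g}$, and $\sigma+j\rho:=e^{j\varphi}\frac{p^\star-jq^\star}{v^{\star2}}$ with $\sigma,\rho\in\mathbb R$. Let $$J=\begin{bmatrix}0&-1\\1&0\end{bmatrix},\quad S=\begin{bmatrix}\sigma&-\rho\\ \rho&\sigma\end{bmatrix},\quad Y_\varphi=\begin{bmatrix}\cos\varphi&-\sin\varphi\\ \sin\varphi&\cos\varphi\end{bmatrix}\begin{bmatrix}r_{\rm g}&-\omega_{\rm g}l_{\rm g}\\ \omega_{\rm g}l_{\rm g}&r_{\rm g}\end{bmatrix}^{-1},\quad \mathbf v_{\rm g}=\begin{bmatrix}v_{\rm g}\\0\end{bmatrix},$$ and consider the reduced second-order system on $\mathbb R^2$ (Euclidean norm) $$\dot{\mathbf v}=\bigl[\omega_\Delta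 J+\eta(S-Y_\varphi)\bigr]\mathbf v+\eta Y_\varphi\mathbf v_{\rm g}+\eta\alpha\,\frac{v^{\star2}-\|\mathbf v\|^2}{v^{\star2}}\,\mathbf v .$$ Let $\mathbf v_{\rm s}\in\mathbb R^2$ be an equilibrium point of this system. If $$\operatorname{Re}\Bigl\{e^{j\varphi}\frac{p^\star-jq^\star}{v^{\star2}}\Bigr\}+\alpha<\frac{\alpha}{v^{\star2}}\|\mathbf v_{\rm s}\|^2+\operatorname{Re}\{e^{j\varphi}y\},$$ then $\mathbf v_{\rm s}$ is locally asymptotically stable: for every $\varepsilon>0$ there is $\delta>0$ such that from each initial state with $\|\mathbf v(0)-\mathbf v_{\rm s}\|<\delta$ a solution exists for all $t\ge0$, and every such solution satisfies $\|\mathbf v(t)-\mathbf v_{\rm s}\|<\varepsilon$ for all $t\ge 0$; and there is $\delta>0$ such that from each initial state with $\|\mathbf v(0)-\mathbf v_{\rm s}\|<\delta$ a solution exists for all $t\ge0$, and every such solution converges to $\mathbf v_{\rm s}$ as $t\to\infty$. -/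

import Mathlib

open Matrix

noncomputable section

/-- The plane `ℝ²` of `dq`-vectors, with the Euclidean norm. -/
abbrev Plane : Type := EuclideanSpace ℝ (Fin 2)

/-! ### Stability notions for an autonomous system `x' = f x` -/

/-- A forward solution of the autonomous system `x' = f x`, i.e. one defined for all `t ≥ 0`
(one-sided derivative at `t = 0`). -/
def IsForwardSolution (f : Plane → Plane) (x : ℝ → Plane) : Prop :=
  IsIntegralCurveOn x (fun _ => f) (Set.Ici 0)

def IsEquilibrium (f : Plane → Plane) (xs : Plane) : Prop := f xs = 0

/-- Lyapunov stability of `xs`: solutions that start close enough to `xs` exist for all `t ≥ 0`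
and stay in a prescribed neighbourhood of `xs`. -/
def IsLyapunovStable (f : Plane → Plane) (xs : Plane) : Prop :=
  ∀ ε > 0, ∃ δ > 0, ∀ x₀ : Plane, ‖x₀ - xs‖ < δ →
    (∃ x : ℝ → Plane, x 0 = x₀ ∧ IsForwardSolution f x) ∧
    ∀ x : ℝ → Plane, x 0 = x₀ → IsForwardSolution f x → ∀ t ≥ 0, ‖x t - xs‖ < ε

/-- Local attractivity of `xs`: solutions that start close enough to `xs` exist for all `t ≥ 0`
and converge to `xs`. -/
def IsLocallyAttractive (f : Plane → Plane) (xs : Plane) : Prop :=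
  ∃ δ > 0, ∀ x₀ : Plane, ‖x₀ - xs‖ < δ →
    (∃ x : ℝ → Plane, x 0 = x₀ ∧ IsForwardSolution f x) ∧
    ∀ x : ℝ → Plane, x 0 = x₀ → IsForwardSolution f x →
      Filter.Tendsto x Filter.atTop (nhds xs)

def IsLocallyAsymptoticallyStable (f : Plane → Plane) (xs : Plane) : Prop :=
  IsLyapunovStable f xs ∧ IsLocallyAttractive f xs

/-! ### The reduced second-order grid-connected converter system -/

/-- The parameters of the grid-connected converter under complex droop control. -/
structure ConverterParams where
  /-- power droop gain -/
  η : ℝ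
  /-- voltage droop gain -/
  α : ℝ
  /-- rotation angle -/
  φ : ℝ
  /-- active power setpoint -/
  pStar : ℝ
  /-- reactive power setpoint -/
  qStar : ℝ
  /-- voltage setpoint -/
  vStar : ℝ
  /-- nominal angular frequency of the converter -/
  ω₀ : ℝ
  /-- grid angular frequency -/
  ωg : ℝ
  /-- grid resistance -/
  rg : ℝ
  /-- grid inductance -/
  lg : ℝ
  /-- grid voltage amplitude -/
  vg : ℝ

namespace ConverterParams

variable (P : ConverterParams)

/-- Complex grid impedance `z = r_g + j ω_g l_g`. -/
def z : ℂ := (P.rg : ℂ) + Complex.I * ((P.ωg * P.lg : ℝ) : ℂ)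

/-- Complex grid admittance `y = z⁻¹`. -/
def y : ℂ := P.z⁻¹

/-- The rotated, conjugated and normalized power setpoint
`e^{jφ} (p⋆ - j q⋆) / v⋆² = σ_φ⋆ + j ρ_φ⋆`. -/
def rotatedSetpoint : ℂ :=
  Complex.exp (Complex.I * (P.φ : ℂ)) *
    (((P.pStar : ℂ) - Complex.I * (P.qStar : ℂ)) / (P.vStar : ℂ) ^ 2)

/-- Frequency mismatch `ω_Δ = ω₀ - ω_g`. -/
def ωΔ : ℝ := P.ω₀ - P.ωg

/-- The matrix `J` (rotation by a quarter turn). -/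
def rotJ : Matrix (Fin 2) (Fin 2) ℝ := !![0, -1; 1, 0]

/-- The rotation matrix `R_φ`. -/
def R : Matrix (Fin 2) (Fin 2) ℝ :=
  !![Real.cos P.φ, -Real.sin P.φ; Real.sin P.φ, Real.cos P.φ]

/-- The impedance matrix `Z`. -/
def Z : Matrix (Fin 2) (Fin 2) ℝ :=
  !![P.rg, -(P.ωg * P.lg); P.ωg * P.lg, P.rg]

/-- The admittance matrix `Y = Z⁻¹`. -/
def Y : Matrix (Fin 2) (Fin 2) ℝ := P.Z⁻¹

/-- The rotated admittance matrix `Y_φ = R_φ Y`. -/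
def Yφ : Matrix (Fin 2) (Fin 2) ℝ := P.R * P.Y

/-- The matrix `S_φ⋆` of the rotated power setpoint, with `σ_φ⋆`, `ρ_φ⋆` the real and imaginary
parts of `e^{jφ} (p⋆ - j q⋆) / v⋆²`. -/
def S : Matrix (Fin 2) (Fin 2) ℝ :=
  !![P.rotatedSetpoint.re, -P.rotatedSetpoint.im; P.rotatedSetpoint.im, P.rotatedSetpoint.re]

/-- The voltage regulation matrix `Φ(v) = ((v⋆² - ‖v‖²) / v⋆²) I₂`. -/
def Φ (v : Plane) : Matrix (Fin 2) (Fin 2) ℝ :=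
  ((P.vStar ^ 2 - ‖v‖ ^ 2) / P.vStar ^ 2) • (1 : Matrix (Fin 2) (Fin 2) ℝ)

/-- The grid voltage vector `[v_g, 0]ᵀ` in the grid synchronous frame. -/
def vgVec : Fin 2 → ℝ := ![P.vg, 0]

/-- Right-hand side of the reduced second-order system
`v' = [ω_Δ J + η (S_φ⋆ - Y_φ)] v + η Y_φ v_g + η α Φ(v) v`. -/
def reducedField (v : Plane) : Plane :=
  WithLp.toLp 2
    ((P.ωΔ • rotJ + P.η • (P.S - P.Yφ)) *ᵥ v.ofLp
      + P.η • (P.Yφ *ᵥ P.vgVec)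
      + (P.η * P.α) • (P.Φ v *ᵥ v.ofLp))

end ConverterParams

end

open scoped NNReal InnerProductSpace

section AutonomousODE

variable {E : Type*} [NormedAddCommGroup E]

/-- A bounded globally Lipschitz vector field on a complete space has forward solutions on every
bounded time interval. -/
theorem exists_isIntegralCurveOn_Icc_of_lipschitzWith_of_bounded [NormedSpace ℝ E]
    [CompleteSpace E] {g : E → E} {K : ℝ≥0} (hg : LipschitzWith K g) {C : ℝ}
    (hC : ∀ v, ‖g v‖ ≤ C) (x₀ : E) {T : ℝ} (hT : 0 ≤ T) :
    ∃ x : ℝ → E, x 0 = x₀ ∧ IsIntegralCurveOn x (fun _ => g) (Set.Icc 0 T) := by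
  have hC0 : 0 ≤ C := (norm_nonneg _).trans (hC x₀)
  have hPL : IsPicardLindelof (fun _ : ℝ => g) (⟨0, le_rfl, hT⟩ : Set.Icc (0 : ℝ) T) x₀
      (C.toNNReal * T.toNNReal) 0 C.toNNReal K :=
    { lipschitzOnWith := fun _ _ => hg.lipschitzOnWith
      continuousOn := fun _ _ => continuousOn_const
      norm_le := fun _ _ v _ => by rw [Real.coe_toNNReal _ hC0]; exact hC v
      mul_max_le := by
        simp [Real.coe_toNNReal _ hC0, Real.coe_toNNReal _ hT, max_eq_left hT] }
  exact hPL.exists_eq_forall_mem_Icc_hasDerivWithinAt₀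

/-- A bounded globally Lipschitz vector field on a complete space has forward solutions defined
for all nonnegative times. -/
theorem exists_isIntegralCurveOn_Ici_of_lipschitzWith_of_bounded [NormedSpace ℝ E]
    [CompleteSpace E] {g : E → E} {K : ℝ≥0} (hg : LipschitzWith K g) {C : ℝ}
    (hC : ∀ v, ‖g v‖ ≤ C) (x₀ : E) :
    ∃ x : ℝ → E, x 0 = x₀ ∧ IsIntegralCurveOn x (fun _ => g) (Set.Ici 0) := by
  choose γ hγ₀ hγ using fun n : ℕ =>
    exists_isIntegralCurveOn_Icc_of_lipschitzWith_of_bounded hg hC x₀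
      (T := (n : ℝ) + 1) (by positivity)
  have hright : ∀ (n : ℕ) (T : ℝ), T ≤ n + 1 → ∀ t ∈ Set.Ico 0 T,
      HasDerivWithinAt (γ n) (g (γ n t)) (Set.Ici t) t := by
    intro n T hT t ht
    refine (hγ n t ⟨ht.1, ht.2.le.trans hT⟩).mono_of_mem_nhdsWithin ?_
    exact Filter.mem_of_superset (Icc_mem_nhdsGE (ht.2.trans_le hT))
      (Set.Icc_subset_Icc_left ht.1)
  have heq : ∀ m n : ℕ, m ≤ n → Set.EqOn (γ m) (γ n) (Set.Icc 0 ((m : ℝ) + 1)) := by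
    intro m n hmn
    have hT : (m : ℝ) + 1 ≤ n + 1 := by exact_mod_cast Nat.succ_le_succ hmn
    exact ODE_solution_unique_of_mem_Icc_right (v := fun _ => g) (s := fun _ => Set.univ) (K := K)
      (fun _ _ => hg.lipschitzOnWith) (hγ m).continuousOn (hright m _ le_rfl)
      (fun _ _ => Set.mem_univ _) ((hγ n).continuousOn.mono (Set.Icc_subset_Icc_right hT))
      (hright n _ hT) (fun _ _ => Set.mem_univ _) ((hγ₀ m).trans (hγ₀ n).symm)
  have hglue : ∀ (n : ℕ), ∀ t ∈ Set.Ico (0 : ℝ) (n + 1), γ ⌈t⌉₊ t = γ n t := by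
    intro n t ht
    have htc : t ∈ Set.Icc (0 : ℝ) ((⌈t⌉₊ : ℝ) + 1) :=
      ⟨ht.1, (Nat.le_ceil t).trans (by linarith)⟩
    rcases le_total ⌈t⌉₊ n with h | h
    · exact heq _ _ h htc
    · exact (heq _ _ h ⟨ht.1, ht.2.le⟩).symm
  refine ⟨fun t => γ ⌈t⌉₊ t, by simpa using hγ₀ 0, fun t ht => ?_⟩
  have htn : t < (⌈t⌉₊ : ℝ) + 1 := (Nat.le_ceil t).trans_lt (by linarith)
  have hnhds : Set.Ico (0 : ℝ) (⌈t⌉₊ + 1) ∈ nhdsWithin t (Set.Ici 0) := by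
    rw [← Set.Ici_inter_Iio]
    exact inter_mem_nhdsWithin _ (Iio_mem_nhds htn)
  have hd : HasDerivWithinAt (γ ⌈t⌉₊) (g (γ ⌈t⌉₊ t)) (Set.Ici 0) t :=
    (hγ ⌈t⌉₊ t ⟨ht, htn.le⟩).mono_of_mem_nhdsWithin
      (Filter.mem_of_superset hnhds Set.Ico_subset_Icc_self)
  exact hd.congr_of_eventuallyEq (Filter.mem_of_superset hnhds (hglue _)) rfl

variable [InnerProductSpace ℝ E]

/-- If the squared distance to `xs` is a strict Lyapunov function with rate `c` on the punctured
ball of radius `r`, then forward solutions that start in a smaller ball converge exponentially. -/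
theorem norm_sub_sq_le_mul_exp_of_inner_lt {F : E → E} {xs : E} {c r δ : ℝ} (hc : 0 ≤ c)
    (hF : ∀ v, 0 < ‖v - xs‖ → ‖v - xs‖ ≤ r → 2 * ⟪v - xs, F v⟫_ℝ < -c * ‖v - xs‖ ^ 2)
    (hδ : 0 < δ) (hδr : δ ≤ r) {x : ℝ → E}
    (hx : IsIntegralCurveOn x (fun _ => F) (Set.Ici 0)) (hx₀ : ‖x 0 - xs‖ ≤ δ)
    {t : ℝ} (ht : 0 ≤ t) :
    ‖x t - xs‖ ^ 2 ≤ δ ^ 2 * Real.exp (-c * t) := by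
  have hderivB (s : ℝ) : HasDerivAt (fun s => δ ^ 2 * Real.exp (-c * s))
      (-c * (δ ^ 2 * Real.exp (-c * s))) s := by
    have h := (((hasDerivAt_id' s).const_mul (-c)).exp).const_mul (δ ^ 2)
    exact h.congr_deriv (by ring)
  have hderiv (s : ℝ) (hs : 0 ≤ s) : HasDerivWithinAt (fun s => ‖x s - xs‖ ^ 2)
      (2 * ⟪x s - xs, F (x s)⟫_ℝ) (Set.Ici 0) s :=
    ((hx s hs).sub_const xs).norm_sq
  refine image_le_of_deriv_right_lt_deriv_boundary' (a := 0) (b := t)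
    (f := fun s => ‖x s - xs‖ ^ 2) (f' := fun s => 2 * ⟪x s - xs, F (x s)⟫_ℝ)
    (B := fun s => δ ^ 2 * Real.exp (-c * s)) (B' := fun s => -c * (δ ^ 2 * Real.exp (-c * s)))
    (fun s hs => (hderiv s hs.1).continuousWithinAt.mono Set.Icc_subset_Ici_self)
    (fun s hs => (hderiv s hs.1).mono (Set.Ici_subset_Ici.2 hs.1)) ?_
    (fun s _ => (hderivB s).continuousAt.continuousWithinAt)
    (fun s _ => (hderivB s).hasDerivWithinAt) ?_ ⟨ht, le_rfl⟩
  · simpa using pow_le_pow_left₀ (norm_nonneg _) hx₀ 2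
  · intro s hs heq
    rw [← heq]
    have hpos : 0 < ‖x s - xs‖ ^ 2 := by rw [heq]; positivity
    have hexp : Real.exp (-c * s) ≤ 1 := Real.exp_le_one_iff.2 (by nlinarith [hs.1])
    refine hF _ (by simpa using hpos.ne') ((abs_le_of_sq_le_sq' ?_ hδ.le).2.trans hδr)
    rw [heq]
    nlinarith [sq_nonneg δ]

/-- Under the hypotheses of `norm_sub_sq_le_mul_exp_of_inner_lt`, a `C¹` vector field has forward
solutions from every initial state in a closed ball of radius at most `r`. -/
theorem exists_isIntegralCurveOn_Ici_of_inner_lt [FiniteDimensional ℝ E] {F : E → E}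
    (hFd : ContDiff ℝ 1 F) {xs : E} {c r : ℝ} (hc : 0 ≤ c) (hr : 0 < r)
    (hF : ∀ v, 0 < ‖v - xs‖ → ‖v - xs‖ ≤ r → 2 * ⟪v - xs, F v⟫_ℝ < -c * ‖v - xs‖ ^ 2)
    {x₀ : E} (hx₀ : ‖x₀ - xs‖ ≤ r) :
    ∃ x : ℝ → E, x 0 = x₀ ∧ IsIntegralCurveOn x (fun _ => F) (Set.Ici 0) := by
  let b : ContDiffBump xs := ⟨r, r + 1, hr, by linarith⟩
  have hgF : ∀ v, ‖v - xs‖ ≤ r → b v • F v = F v := fun v hv => by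
    rw [b.one_of_mem_closedBall (by simpa [b, dist_eq_norm] using hv), one_smul]
  have hgd : ContDiff ℝ 1 (fun v => b v • F v) := b.contDiff.smul hFd
  have hgs : HasCompactSupport (fun v => b v • F v) := b.hasCompactSupport.smul_right
  obtain ⟨K, hK⟩ : ∃ K, LipschitzWith K (fun v => b v • F v) :=
    ContDiff.lipschitzWith_of_hasCompactSupport hgs hgd (by simp)
  obtain ⟨C, hC⟩ := hgs.exists_bound_of_continuous hgd.continuous
  obtain ⟨x, hx0, hx⟩ := exists_isIntegralCurveOn_Ici_of_lipschitzWith_of_bounded hK hC x₀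
  refine ⟨x, hx0, fun t ht => ?_⟩
  have hle := norm_sub_sq_le_mul_exp_of_inner_lt hc
    (fun v hv hvr => by rw [hgF v hvr]; exact hF v hv hvr) hr le_rfl hx (hx0 ▸ hx₀) ht
  have hexp : Real.exp (-c * t) ≤ 1 :=
    Real.exp_le_one_iff.2 (by nlinarith [Set.mem_Ici.1 ht])
  have hxt : ‖x t - xs‖ ≤ r :=
    (abs_le_of_sq_le_sq' (hle.trans (by nlinarith [sq_nonneg r])) hr.le).2
  simpa only [hgF _ hxt] using hx t ht

end AutonomousODE

/-- The squared distance to `xs` being a strict Lyapunov function near `xs` implies local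
asymptotic stability of a `C¹` planar system. -/
theorem isLocallyAsymptoticallyStable_of_inner_lt {F : Plane → Plane} (hFd : ContDiff ℝ 1 F)
    {xs : Plane} {c r : ℝ} (hc : 0 < c) (hr : 0 < r)
    (hF : ∀ v, 0 < ‖v - xs‖ → ‖v - xs‖ ≤ r → 2 * ⟪v - xs, F v⟫_ℝ < -c * ‖v - xs‖ ^ 2) :
    IsLocallyAsymptoticallyStable F xs := by
  refine ⟨fun ε hε => ⟨min (ε / 2) r, by positivity, fun x₀ hx₀ => ⟨?_, ?_⟩⟩,
    r, hr, fun x₀ hx₀ => ⟨?_, ?_⟩⟩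
  · exact exists_isIntegralCurveOn_Ici_of_inner_lt hFd hc.le hr hF
      (hx₀.le.trans (min_le_right _ _))
  · rintro x rfl hx t ht
    have hδ : 0 < min (ε / 2) r := by positivity
    have hle := norm_sub_sq_le_mul_exp_of_inner_lt hc.le hF hδ (min_le_right _ _) hx hx₀.le ht
    have hexp : Real.exp (-c * t) ≤ 1 := Real.exp_le_one_iff.2 (by nlinarith)
    have hxt : ‖x t - xs‖ ≤ min (ε / 2) r :=
      (abs_le_of_sq_le_sq' (hle.trans (by nlinarith [sq_nonneg (min (ε / 2) r)])) hδ.le).2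
    linarith [min_le_left (ε / 2) r]
  · exact exists_isIntegralCurveOn_Ici_of_inner_lt hFd hc.le hr hF hx₀.le
  · rintro x rfl hx
    have hexp : Filter.Tendsto (fun t => r ^ 2 * Real.exp (-c * t)) Filter.atTop (nhds 0) := by
      have h := (Real.tendsto_exp_atBot.comp
        (Filter.tendsto_id.const_mul_atTop_of_neg (neg_lt_zero.2 hc))).const_mul (r ^ 2)
      simpa using h
    have hsq : Filter.Tendsto (fun t => ‖x t - xs‖ ^ 2) Filter.atTop (nhds 0) :=
      squeeze_zero' (Filter.Eventually.of_forall fun _ => by positivity)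
        ((Filter.eventually_ge_atTop 0).mono fun t ht =>
          norm_sub_sq_le_mul_exp_of_inner_lt hc.le hF hr le_rfl hx hx₀.le ht) hexp
    rw [tendsto_iff_norm_sub_tendsto_zero]
    simpa [Real.sqrt_sq] using hsq.sqrt

namespace ConverterParams

variable (P : ConverterParams)

/-- The rotated complex admittance `e^{jφ} y`. -/
noncomputable def rotatedAdmittance : ℂ := Complex.exp (Complex.I * (P.φ : ℂ)) * P.y

theorem Yφ_eq_rotatedAdmittance (hz : P.z ≠ 0) :
    P.Yφ = !![P.rotatedAdmittance.re, -P.rotatedAdmittance.im;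
      P.rotatedAdmittance.im, P.rotatedAdmittance.re] := by
  have hn : P.rg * P.rg + P.ωg * P.lg * (P.ωg * P.lg) ≠ 0 := by
    have := Complex.normSq_pos.2 hz
    simp [z, Complex.normSq_apply] at this
    exact this.ne'
  have hinv : P.Z⁻¹ = (P.rg * P.rg + P.ωg * P.lg * (P.ωg * P.lg))⁻¹ •
      !![P.rg, P.ωg * P.lg; -(P.ωg * P.lg), P.rg] := by
    rw [Matrix.inv_def, Z, Matrix.det_fin_two_of, Matrix.adjugate_fin_two_of, Ring.inverse_eq_inv']
    simp
  rw [Yφ, Y, hinv, R, rotatedAdmittance, y, z, mul_comm Complex.I (P.φ : ℂ)]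
  ext i j
  fin_cases i <;> fin_cases j <;>
    simp [Matrix.mul_apply, Fin.sum_univ_two, Complex.normSq_apply, Complex.exp_ofReal_mul_I_re,
      Complex.exp_ofReal_mul_I_im, Complex.inv_re, Complex.inv_im] <;>
    field_simp <;> ring

theorem norm_sq_eq_add_sq (v : Plane) : ‖v‖ ^ 2 = v 0 ^ 2 + v 1 ^ 2 := by
  rw [EuclideanSpace.real_norm_sq_eq, Fin.sum_univ_two]

/-- Coordinates of the reduced vector field, in terms of the complex parameters. -/
theorem reducedField_eq (hz : P.z ≠ 0) (v : Plane) :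
    P.reducedField v = !₂[
      P.η * (P.rotatedSetpoint.re - P.rotatedAdmittance.re) * v 0
        - (P.ωΔ + P.η * (P.rotatedSetpoint.im - P.rotatedAdmittance.im)) * v 1
        + P.η * (P.rotatedAdmittance.re * P.vg)
        + P.η * P.α * ((P.vStar ^ 2 - (v 0 ^ 2 + v 1 ^ 2)) / P.vStar ^ 2) * v 0,
      P.η * (P.rotatedSetpoint.re - P.rotatedAdmittance.re) * v 1
        + (P.ωΔ + P.η * (P.rotatedSetpoint.im - P.rotatedAdmittance.im)) * v 0
        + P.η * (P.rotatedAdmittance.im * P.vg)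
        + P.η * P.α * ((P.vStar ^ 2 - (v 0 ^ 2 + v 1 ^ 2)) / P.vStar ^ 2) * v 1] := by
  rw [reducedField, P.Yφ_eq_rotatedAdmittance hz, Φ, norm_sq_eq_add_sq, S, rotJ, vgVec]
  ext i
  fin_cases i <;>
    simp [dotProduct, Fin.sum_univ_two, Matrix.vecHead, Matrix.vecTail] <;> ring

theorem contDiff_reducedField (hz : P.z ≠ 0) : ContDiff ℝ 1 P.reducedField := by
  have h : P.reducedField = _ := funext (P.reducedField_eq hz)
  rw [h, contDiff_euclidean]
  intro i
  have h0 : ContDiff ℝ 1 fun v : Plane => v 0 := contDiff_euclidean.1 contDiff_id 0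
  have h1 : ContDiff ℝ 1 fun v : Plane => v 1 := contDiff_euclidean.1 contDiff_id 1
  fin_cases i <;> simp <;> fun_prop

/-- The squared distance to an equilibrium decays along the reduced vector field, up to a term of
fourth order. -/
theorem inner_reducedField_le (hη : 0 < P.η) (hα : 0 ≤ P.α) (hvStar : 0 < P.vStar)
    (hz : P.z ≠ 0) {vs : Plane} (hvs : IsEquilibrium P.reducedField vs) (v : Plane) :
    2 * ⟪v - vs, P.reducedField v⟫_ℝ ≤
      -(2 * P.η * (P.α / P.vStar ^ 2 * ‖vs‖ ^ 2 + P.rotatedAdmittance.re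
          - (P.rotatedSetpoint.re + P.α))) * ‖v - vs‖ ^ 2
        + P.η * P.α / P.vStar ^ 2 / 4 * (‖v - vs‖ ^ 2) ^ 2 := by
  have hs : P.vStar ^ 2 ≠ 0 := by positivity
  have hk : 0 ≤ P.η * P.α / P.vStar ^ 2 := by positivity
  have hsub : ⟪v - vs, P.reducedField v⟫_ℝ =
      ⟪v - vs, P.reducedField v - P.reducedField vs⟫_ℝ := by
    rw [show P.reducedField vs = 0 from hvs, sub_zero]
  have hdiv (n : ℝ) : P.η * P.α * ((P.vStar ^ 2 - n) / P.vStar ^ 2) =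
      P.η * P.α - P.η * P.α / P.vStar ^ 2 * n := by
    field_simp
  have hk' : 2 * P.η * (P.α / P.vStar ^ 2 * ‖vs‖ ^ 2 + P.rotatedAdmittance.re
          - (P.rotatedSetpoint.re + P.α)) =
      2 * (P.η * P.α / P.vStar ^ 2) * ‖vs‖ ^ 2 + 2 * P.η * P.rotatedAdmittance.re
          - 2 * P.η * P.rotatedSetpoint.re - 2 * (P.η * P.α) := by
    ring
  rw [hsub, hk', P.reducedField_eq hz, P.reducedField_eq hz]
  simp only [norm_sq_eq_add_sq, PiLp.inner_apply, Fin.sum_univ_two, hdiv]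
  generalize P.η * P.α / P.vStar ^ 2 = k at hk
  simp
  have hsq := mul_nonneg hk (sq_nonneg (4 * (vs 0 * (v 0 - vs 0) + vs 1 * (v 1 - vs 1))
    + 3 * ((v 0 - vs 0) ^ 2 + (v 1 - vs 1) ^ 2)))
  linarith

end ConverterParams

theorem mainTheorem8 (P : ConverterParams)
    (hη : 0 < P.η) (hα : 0 ≤ P.α) (hvStar : 0 < P.vStar) (hz : P.z ≠ 0)
    (vs : Plane) (hvs : IsEquilibrium P.reducedField vs)
    (hcond :
      (Complex.exp (Complex.I * (P.φ : ℂ)) *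
          (((P.pStar : ℂ) - Complex.I * (P.qStar : ℂ)) / (P.vStar : ℂ) ^ 2)).re + P.α
        < P.α / P.vStar ^ 2 * ‖vs‖ ^ 2
          + (Complex.exp (Complex.I * (P.φ : ℂ)) * P.y).re) :
    IsLocallyAsymptoticallyStable P.reducedField vs := by
  change P.rotatedSetpoint.re + P.α
    < P.α / P.vStar ^ 2 * ‖vs‖ ^ 2 + P.rotatedAdmittance.re at hcond
  have hle := P.inner_reducedField_le hη hα hvStar hz hvs
  set d := P.α / P.vStar ^ 2 * ‖vs‖ ^ 2 + P.rotatedAdmittance.re - (P.rotatedSetpoint.re + P.α)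
    with hd
  have hd0 : 0 < P.η * d := mul_pos hη (by linarith)
  set k := P.η * P.α / P.vStar ^ 2 / 4 with hkdef
  have hk : 0 ≤ k := by positivity
  refine isLocallyAsymptoticallyStable_of_inner_lt (P.contDiff_reducedField hz) hd0
    (r := Real.sqrt (P.η * d / (k + 1))) (by positivity) fun v hv hvr => (hle v).trans_lt ?_
  have hsq : ‖v - vs‖ ^ 2 ≤ P.η * d / (k + 1) := by
    rw [← Real.sq_sqrt (show 0 ≤ P.η * d / (k + 1) by positivity)]
    exact pow_le_pow_left₀ hv.le hvr 2
  rw [le_div_iff₀ (by positivity)] at hsq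
  have hn : 0 < ‖v - vs‖ ^ 2 := by positivity
  have hlt : k * ‖v - vs‖ ^ 2 < P.η * d := by linarith
  nlinarith [mul_lt_mul_of_pos_right hlt hn]
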